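/- Consider the binary additive two-way wire-tap channel. Users $1$ and $2$ send binary words $\mathbf X_1,\mathbf X_2\in\{0,1\}^n$; receiver $k$ (located at user $k$, $k=1,2$) gets $\mathbf Y_k=\mathbf X_1\oplus\mathbf X_2\oplus\mathbf E_k$ and the eavesdropper gets $\mathbf Z=\mathbf X_1\oplus\mathbf X_2\oplus\mathbf E_W$. The error vectors $\mathbf E_1,\mathbf E_2,\mathbf E_W$ are independent of each other and of the transmitted words, and have i.i.d. Bernoulli components with parameters $\varepsilon_1,\varepsilon_2,\varepsilon_W\in[0,\tfrac12)$ respectively. In a code of length $n$, user $k$ has a message $W_k$, the pair $\mathbf W=(W_1,W_2)$ being uniform on $\{1,\dots,M_1\}\times\{1,\dots,M_2\}$, and draws $\mathbf X_k$ from a conditional distribution given $W_k$ (a stochastic encoder; the two users randomize independently). Receiver $1$ forms an estimate $\hat W_2$ of $W_2$ from $(\mathbf X_1,\mathbf Y_1)$, and receiver $2$ an estimate $\hat W_1$ of $W_1$ from $(\mathbf X_2,\mathbf Y_2)$; put $\hat{\mathbf W}=(\hat W_1,\hat W_2)$. A pair $(R_1,R_2)$ is achievable with perfect secrecy if for every $\delta>0$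 and all sufficiently large $n$ there is a code of length $n$ with $M_1M_2\ge 2$ such that $$\tfrac1n\log_2 M_k\ge R_k-\delta\ (k=1,2),\qquad \frac1{M_1M_2}\sum_{\mathbf w}\Pr\{\hat{\mathbf W}\ne\mathbf w\mid\mathbf W=\mathbf w\}\le\delta,\qquad \frac{H(\mathbf W\mid\mathbf Z)}{H(\mathbf W)}\ge 1-\delta .$$ Theorem. Let $h(\xi)=-\xi\log_2\xi-(1-\xi)\log_2(1-\xi)$ (with $0\log_2 0=0$) and $[\xi]^+=\max\{\xi,0\}$. Every pair $(R_1,R_2)$ of real numbers with $$R_1\le 1-h(\varepsilon_2),\qquad R_2\le 1-h(\varepsilon_1),\qquad R_1+R_2\le\big[1+h(\varepsilon_W)-h(\varepsilon_1)-h(\varepsilon_2)\big]^+$$ is achievable with perfect secrecy. -/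

import Mathlib

open Filter

namespace BATW

/-- Binary words of length `n`; `+` is the componentwise XOR. -/
abbrev Word (n : ℕ) : Type := Fin n → ZMod 2

/-- The binary entropy function in bits. -/
noncomputable def h (ξ : ℝ) : ℝ := -ξ * Real.logb 2 ξ - (1 - ξ) * Real.logb 2 (1 - ξ)

/-- The probability of the error vector `e` when its components are independent and each of
them equals `1` with probability `ε`. -/
noncomputable def noise (ε : ℝ) {n : ℕ} (e : Word n) : ℝ :=
  ∏ i, if e i = 1 then ε else 1 - ε

/-- A code of length `n` for the two-way wire-tap channel: the users have `M₁` resp. `M₂` messages; each sends a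
word drawn by a (stochastic) encoder from its message. Receiver 1 estimates the message of user 2
from the word it has itself sent and the word it receives (in this order), and vice versa. -/
structure Code (n : ℕ) where
  M₁ : ℕ
  M₂ : ℕ
  M₁_pos : 0 < M₁
  M₂_pos : 0 < M₂
  enc₁ : Fin M₁ → PMF (Word n)
  enc₂ : Fin M₂ → PMF (Word n)
  dec₁ : Word n → Word n → Fin M₂
  dec₂ : Word n → Word n → Fin M₁

variable {n : ℕ}

namespace Code

/-- The pairs of messages `(W₁, W₂)`. -/
abbrev Msg (c : Code n) : Type := Fin c.M₁ × Fin c.M₂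

/-- The conditional probability, given that the messages `w` were sent, that users 1 and 2 transmit
`x₁` and `x₂` and that the error vectors at receiver 1, at receiver 2 and at the eavesdropper are
`e₁`, `e₂` and `e₃`; the two encoders and the three error vectors act independently. -/
noncomputable def condLaw (c : Code n) (ε₁ ε₂ εW : ℝ) (w : c.Msg)
    (x₁ x₂ e₁ e₂ e₃ : Word n) : ℝ :=
  (c.enc₁ w.1 x₁).toReal * (c.enc₂ w.2 x₂).toReal *
    (noise ε₁ e₁ * noise ε₂ e₂ * noise εW e₃)

/-- The messages as decoded at the two receivers. -/
def decode (c : Code n) (x₁ x₂ e₁ e₂ : Word n) : c.Msg :=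
  (c.dec₂ x₂ (x₁ + x₂ + e₂), c.dec₁ x₁ (x₁ + x₂ + e₁))

/-- The average probability that the decoded messages differ from the sent messages. -/
noncomputable def errorProb (c : Code n) (ε₁ ε₂ εW : ℝ) : ℝ :=
  1 / ((c.M₁ : ℝ) * c.M₂) * ∑ w : c.Msg,
    ∑ x₁, ∑ x₂, ∑ e₁, ∑ e₂, ∑ e₃,
      if c.decode x₁ x₂ e₁ e₂ ≠ w then c.condLaw ε₁ ε₂ εW w x₁ x₂ e₁ e₂ e₃ else 0

/-- The law of the messages: all pairs are equally likely. -/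
noncomputable def msgLaw (c : Code n) (_w : c.Msg) : ℝ := 1 / ((c.M₁ : ℝ) * c.M₂)

/-- The joint law of the messages and the word `Z = X₁ ⊕ X₂ ⊕ E` that the eavesdropper sees. -/
noncomputable def tapLaw (c : Code n) (ε₁ ε₂ εW : ℝ) (w : c.Msg) (z : Word n) : ℝ :=
  c.msgLaw w * ∑ x₁, ∑ x₂, ∑ e₁, ∑ e₂, ∑ e₃,
    if x₁ + x₂ + e₃ = z then c.condLaw ε₁ ε₂ εW w x₁ x₂ e₁ e₂ e₃ else 0

end Code

/-- The Shannon entropy, in bits, of a law on a finite set. -/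
noncomputable def entropy {α : Type*} [Fintype α] (p : α → ℝ) : ℝ :=
  -∑ a, p a * Real.logb 2 (p a)

/-- The conditional Shannon entropy `H(A | B)`, in bits, of a joint law `p` of `(A, B)`. -/
noncomputable def condEntropy {α β : Type*} [Fintype α] [Fintype β] (p : α → β → ℝ) : ℝ :=
  -∑ a, ∑ b, p a b * Real.logb 2 (p a b / ∑ a', p a' b)

/-- `(R₁, R₂)` is an achievable pair of secrecy rates for the binary additive two-way wire-tap
channel with error probabilities `ε₁`, `ε₂` at the receivers and `εW` at the eavesdropper.
In the secrecy condition, a code with a single pair of messages has `0 / 0 = 0` on the left, so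
that such codes are not admitted when `δ < 1`. -/
def Achievable (ε₁ ε₂ εW R₁ R₂ : ℝ) : Prop :=
  ∀ δ : ℝ, 0 < δ → ∀ᶠ n : ℕ in atTop, ∃ c : Code n,
    R₁ - δ ≤ 1 / (n : ℝ) * Real.logb 2 c.M₁ ∧
    R₂ - δ ≤ 1 / (n : ℝ) * Real.logb 2 c.M₂ ∧
    c.errorProb ε₁ ε₂ εW ≤ δ ∧
    1 - δ ≤ condEntropy (c.tapLaw ε₁ ε₂ εW) / entropy c.msgLaw

end BATW

namespace BATW

open Finset
open scoped BigOperators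

/-! ### Binary entropy -/

/-! The proof is random coding with random binning. User `k` has a codebook of `M_k × L_k`
independent uniform words; the message selects the row and private randomness selects the column. A
receiver cancels its own word and is left with a binary symmetric channel, over which
maximum-likelihood decoding finds the row with high probability if `(M - 1) * L` stays exponentially
below `2 ^ (n * (1 - h ε))` (`expect_missProb_le`, `sum_noise_mul_min_le`).

The eavesdropper sees a noisy sum of two codewords. Given the messages, this sum has `L₁ * L₂`
equally likely forms; once that number reaches `2 ^ (n * (1 - h εW))`, the law of the output has
divergence `o(n)` from uniform on average over the codebooks (`expect_leakage_le`,
`sum_noise_mul_logb_le`). That divergence bounds the information leaked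
(`le_condEntropy_of_uniform`), and it is negligible against `H(W)`, which grows linearly in `n`.

For two positive rates, each user spends the capacity left over by its message on randomization, and
the sum-rate bound says exactly that the two amounts together hide the messages. If one rate is not
positive, that user sends no information and jams; its codebook need not be decodable, so it may be
as large as the whole space. -/

lemma h_eq_binEntropy (ξ : ℝ) : h ξ = Real.binEntropy ξ / Real.log 2 := by
  simp only [h, Real.binEntropy, Real.logb, Real.log_inv]
  ring

lemma h_nonneg {ξ : ℝ} (h0 : 0 ≤ ξ) (h1 : ξ < 1 / 2) : 0 ≤ h ξ := by
  rw [h_eq_binEntropy]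
  exact div_nonneg (Real.binEntropy_nonneg h0 (by linarith)) (Real.log_nonneg (by norm_num))

lemma h_lt_one {ξ : ℝ} (h1 : ξ < 1 / 2) : h ξ < 1 := by
  rw [h_eq_binEntropy, div_lt_one (Real.log_pos (by norm_num))]
  exact Real.binEntropy_lt_log_two.2 (by norm_num at h1 ⊢; linarith)

/-! ### The Bernoulli noise -/

/-- The law of one component of the noise. -/
noncomputable def bit (ε : ℝ) (b : ZMod 2) : ℝ := if b = 1 then ε else 1 - ε

lemma sum_zmod_two (g : ZMod 2 → ℝ) : ∑ b, g b = g 0 + g 1 :=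
  Fin.sum_univ_two g

lemma noise_eq_prod_bit (ε : ℝ) {n : ℕ} (e : Word n) : noise ε e = ∏ i, bit ε (e i) := rfl

lemma bit_nonneg {ε : ℝ} (h0 : 0 ≤ ε) (h1 : ε < 1 / 2) (b : ZMod 2) : 0 ≤ bit ε b := by
  unfold bit; split_ifs <;> linarith

lemma noise_nonneg {ε : ℝ} (h0 : 0 ≤ ε) (h1 : ε < 1 / 2) {n : ℕ} (e : Word n) :
    0 ≤ noise ε e :=
  prod_nonneg fun i _ => bit_nonneg h0 h1 (e i)

lemma sum_bit (ε : ℝ) : ∑ b, bit ε b = 1 := by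
  rw [sum_zmod_two]; simp [bit]

lemma sum_word_succ {n : ℕ} (g : Word (n + 1) → ℝ) :
    ∑ e, g e = ∑ b : ZMod 2, ∑ e : Word n, g (Fin.cons b e) := by
  rw [← Fintype.sum_prod_type' (f := fun b (e : Word n) => g (Fin.cons b e))]
  exact (Fintype.sum_equiv (Fin.consEquiv fun _ : Fin (n + 1) => ZMod 2) _ _ fun _ => rfl).symm

lemma noise_cons (ε : ℝ) {n : ℕ} (b : ZMod 2) (e : Word n) :
    noise ε (Fin.cons b e : Word (n + 1)) = bit ε b * noise ε e := by
  simp [noise_eq_prod_bit, Fin.prod_univ_succ]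

lemma sum_noise (ε : ℝ) (n : ℕ) : ∑ e : Word n, noise ε e = 1 := by
  induction n with
  | zero => simp [noise]
  | succ n ih =>
    simp_rw [sum_word_succ, noise_cons, ← mul_sum, ih, mul_one, sum_bit]

/-! ### Mean and variance of sums over independent noise components -/

section Moments

variable (ε : ℝ) (g : ZMod 2 → ℝ)

lemma sum_noise_mul_sum (hg : ∑ b, bit ε b * g b = 0) (n : ℕ) :
    ∑ e : Word n, noise ε e * ∑ i, g (e i) = 0 := by
  induction n with
  | zero => simp
  | succ n ih =>
    have : ∀ b (e : Word n), bit ε b * noise ε e * (g b + ∑ i, g (e i)) =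
        bit ε b * g b * noise ε e + bit ε b * (noise ε e * ∑ i, g (e i)) := fun b e => by ring
    simp_rw [sum_word_succ, noise_cons, Fin.sum_univ_succ, Fin.cons_zero, Fin.cons_succ, this,
      sum_add_distrib, ← mul_sum, ih, sum_noise, mul_one, mul_zero, hg, sum_const_zero, add_zero]

lemma sum_noise_mul_sum_sq (hg : ∑ b, bit ε b * g b = 0) (n : ℕ) :
    ∑ e : Word n, noise ε e * (∑ i, g (e i)) ^ 2 = n * ∑ b, bit ε b * g b ^ 2 := by
  induction n with
  | zero => simp
  | succ n ih =>
    have : ∀ b (e : Word n), bit ε b * noise ε e * (g b + ∑ i, g (e i)) ^ 2 =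
        bit ε b * g b ^ 2 * noise ε e + 2 * (bit ε b * g b) * (noise ε e * ∑ i, g (e i)) +
          bit ε b * (noise ε e * (∑ i, g (e i)) ^ 2) := fun b e => by ring
    simp_rw [sum_word_succ, noise_cons, Fin.sum_univ_succ, Fin.cons_zero, Fin.cons_succ, this,
      sum_add_distrib, ← mul_sum, sum_noise_mul_sum ε g hg, ih, sum_noise, mul_one, mul_zero,
      sum_const_zero, ← sum_mul, sum_bit]
    push_cast
    ring

end Moments

/-- The centred information content of a noise word. -/
noncomputable def infoDev (ε : ℝ) {n : ℕ} (e : Word n) : ℝ :=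
  ∑ i, (Real.logb 2 (bit ε (e i)) + h ε)

/-- The variance of the information content of one component of the noise. -/
noncomputable def infoVar (ε : ℝ) : ℝ :=
  ∑ b, bit ε b * (Real.logb 2 (bit ε b) + h ε) ^ 2

lemma sum_noise_mul_infoDev_sq (ε : ℝ) (n : ℕ) :
    ∑ e : Word n, noise ε e * infoDev ε e ^ 2 = n * infoVar ε := by
  refine sum_noise_mul_sum_sq ε (fun b => Real.logb 2 (bit ε b) + h ε) ?_ n
  rw [sum_zmod_two]
  simp [bit, h]
  ring

/-- This turns deviations of the information content into bounds on probabilities. Words of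
probability zero, which occur when `ε = 0`, are excluded because `Real.logb 2 0 = 0`. -/
lemma noise_eq_two_rpow {ε : ℝ} (h0 : 0 ≤ ε) (h1 : ε < 1 / 2) {n : ℕ} {e : Word n}
    (he : noise ε e ≠ 0) : noise ε e = 2 ^ (infoDev ε e - n * h ε) := by
  have hb : ∀ i, bit ε (e i) ≠ 0 := fun i => prod_ne_zero_iff.1 he i (mem_univ i)
  have hlog : Real.logb 2 (noise ε e) = infoDev ε e - n * h ε := by
    rw [noise_eq_prod_bit, Real.logb, Real.log_prod (fun i _ => hb i), infoDev, sum_add_distrib]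
    simp [Real.logb, sum_div]
  rw [← hlog, Real.rpow_logb (by norm_num) (by norm_num)
    (lt_of_le_of_ne (noise_nonneg h0 h1 e) he.symm)]

/-! ### Chebyshev's inequality for the information content -/

/-- Average `|x| ≤ x ^ 2 / s + s` with `s = n * θ`: as the variance is linear in `n`, the mean
deviation is at most an arbitrarily small multiple of `n` plus a constant. -/
lemma sum_noise_abs_infoDev_le {ε : ℝ} (h0 : 0 ≤ ε) (h1 : ε < 1 / 2) {n : ℕ} (hn : 0 < n)
    {θ : ℝ} (hθ : 0 < θ) :
    ∑ e : Word n, noise ε e * |infoDev ε e| ≤ infoVar ε / θ + n * θ := by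
  have hn' : (0 : ℝ) < n := by exact_mod_cast hn
  have key : ∀ x : ℝ, |x| ≤ x ^ 2 / (n * θ) + n * θ := by
    intro x
    have hp : 0 < n * θ := by positivity
    rw [← sub_le_iff_le_add, le_div_iff₀ hp, ← sq_abs x]
    nlinarith [sq_nonneg (|x| - n * θ), abs_nonneg x]
  calc ∑ e : Word n, noise ε e * |infoDev ε e|
      ≤ ∑ e : Word n, noise ε e * (infoDev ε e ^ 2 / (n * θ) + n * θ) :=
        sum_le_sum fun e _ => mul_le_mul_of_nonneg_left (key _) (noise_nonneg h0 h1 e)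
    _ = (∑ e : Word n, noise ε e * infoDev ε e ^ 2) / (n * θ) +
          (∑ e : Word n, noise ε e) * (n * θ) := by
        simp_rw [mul_add, sum_add_distrib, sum_mul, sum_div, mul_div_assoc]
    _ = infoVar ε / θ + n * θ := by
        rw [sum_noise_mul_infoDev_sq, sum_noise]
        field_simp

/-- The probability-weighted truncated inverse of the noise law, which governs random coding. -/
lemma sum_noise_mul_min_le {ε : ℝ} (h0 : 0 ≤ ε) (h1 : ε < 1 / 2) {n : ℕ} (hn : 0 < n)
    {η : ℝ} (hη : 0 < η) {K : ℝ} (hK : K ≤ 2 * 2 ^ (-(n * (h ε + 2 * η)))) :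
    ∑ e : Word n, noise ε e * min 1 (K / noise ε e) ≤
      infoVar ε / (n * η ^ 2) + 2 * 2 ^ (-(n * η)) := by
  have hn' : (0 : ℝ) < n := by exact_mod_cast hn
  have key : ∀ e : Word n, noise ε e * min 1 (K / noise ε e) ≤
      noise ε e * (infoDev ε e ^ 2 / (n * η) ^ 2) + noise ε e * (2 * 2 ^ (-(n * η))) := by
    intro e
    rcases eq_or_ne (noise ε e) 0 with he | he
    · simp [he]
    have hpos : 0 < noise ε e := lt_of_le_of_ne (noise_nonneg h0 h1 e) he.symm
    rw [← mul_add]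
    refine mul_le_mul_of_nonneg_left ?_ hpos.le
    have hr : (0 : ℝ) < 2 * 2 ^ (-(n * η)) := by positivity
    -- Atypically improbable words are charged to Chebyshev. For the others, one of the two `η` in
    -- the bound on `K` absorbs the deviation and the other remains as exponential decay.
    rcases le_total (infoDev ε e) (-(n * η)) with hd | hd
    · refine (min_le_left _ _).trans ?_
      have : 1 ≤ infoDev ε e ^ 2 / (n * η) ^ 2 := by
        rw [one_le_div (by positivity), ← neg_sq (infoDev ε e)]
        exact pow_le_pow_left₀ (by positivity) (by linarith) 2
      linarith
    · refine (min_le_right _ _).trans ?_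
      have : K / noise ε e ≤ 2 * 2 ^ (-(n * η)) := by
        rw [div_le_iff₀ hpos, noise_eq_two_rpow h0 h1 he, mul_assoc, ← Real.rpow_add two_pos]
        refine hK.trans (mul_le_mul_of_nonneg_left ?_ (by norm_num))
        exact Real.rpow_le_rpow_of_exponent_le (by norm_num) (by nlinarith)
      have : 0 ≤ infoDev ε e ^ 2 / (n * η) ^ 2 := by positivity
      linarith
  refine (sum_le_sum fun e _ => key e).trans ?_
  simp_rw [sum_add_distrib, ← sum_mul, sum_noise, ← mul_div_assoc, ← sum_div,
    sum_noise_mul_infoDev_sq, one_mul]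
  refine add_le_add_left (le_of_eq ?_) _
  field_simp

/-- The factor `K` at most cancels the typical size `2 ^ (-(n * h ε))`, so the logarithm is at most
one plus the absolute deviation. -/
lemma sum_noise_mul_logb_le {ε : ℝ} (h0 : 0 ≤ ε) (h1 : ε < 1 / 2) {n : ℕ} (hn : 0 < n)
    {θ : ℝ} (hθ : 0 < θ) {K : ℝ} (hK0 : 0 ≤ K) (hK : K ≤ 2 ^ (n * h ε)) :
    ∑ e : Word n, noise ε e * Real.logb 2 (1 + K * noise ε e) ≤
      1 + infoVar ε / θ + n * θ := by
  have key : ∀ e : Word n, noise ε e * Real.logb 2 (1 + K * noise ε e) ≤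
      noise ε e + noise ε e * |infoDev ε e| := by
    intro e
    rcases eq_or_ne (noise ε e) 0 with he | he
    · simp [he]
    have hpos : 0 < noise ε e := lt_of_le_of_ne (noise_nonneg h0 h1 e) he.symm
    rw [← mul_one_add]
    refine mul_le_mul_of_nonneg_left ?_ hpos.le
    rw [Real.logb_le_iff_le_rpow (by norm_num) (by positivity), Real.rpow_add two_pos,
      Real.rpow_one]
    have a1 : K * noise ε e ≤ 2 ^ |infoDev ε e| := by
      calc K * noise ε e ≤ 2 ^ (n * h ε) * noise ε e := by gcongr
        _ = 2 ^ infoDev ε e := by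
          rw [noise_eq_two_rpow h0 h1 he, ← Real.rpow_add two_pos]; congr 1; ring
        _ ≤ _ := Real.rpow_le_rpow_of_exponent_le (by norm_num) (le_abs_self _)
    have a2 : (1 : ℝ) ≤ 2 ^ |infoDev ε e| := Real.one_le_rpow (by norm_num) (abs_nonneg _)
    linarith
  refine (sum_le_sum fun e _ => key e).trans ?_
  rw [sum_add_distrib, sum_noise, add_assoc]
  exact add_le_add_right (sum_noise_abs_infoDev_le h0 h1 hn hθ) 1

end BATW

namespace BATW

open Finset
open scoped BigOperators

/-! ### Random codebooks -/

lemma word_add_self {n : ℕ} (x : Word n) : x + x = 0 :=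
  funext fun i => CharTwo.add_self_eq_zero (x i)

lemma word_add_cancel {n : ℕ} (x e : Word n) : x + e + x = e := by
  rw [add_comm x e, add_assoc, word_add_self, add_zero]

/-- Two distinct entries of a uniformly random codebook differ by a uniformly random word. -/
lemma expect_codebook {A : Type*} [Fintype A] [DecidableEq A] {n : ℕ} (g : Word n → ℝ) {a b : A}
    (hab : a ≠ b) (c : Word n) :
    𝔼 f : A → Word n, g (f a + c + f b) = 𝔼 v : Word n, g v := by
  -- Translating entry `a` by `v` permutes the codebooks and leaves entry `b` alone, so one may
  -- average over `v` as well.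
  have shift : ∀ v : Word n, 𝔼 f : A → Word n, g (v + (f a + c + f b)) =
      𝔼 f : A → Word n, g (f a + c + f b) := fun v =>
    Fintype.expect_equiv (Equiv.addRight (Pi.single a v)) _ _ fun f => by
      simp only [Equiv.coe_addRight, Pi.add_apply, Pi.single_eq_same,
        Pi.single_eq_of_ne hab.symm, add_zero]
      congr 1
      abel
  calc 𝔼 f : A → Word n, g (f a + c + f b)
      = 𝔼 v : Word n, 𝔼 f : A → Word n, g (v + (f a + c + f b)) := by
        rw [expect_congr rfl fun v _ => shift v, Fintype.expect_const]
    _ = 𝔼 f : A → Word n, 𝔼 v : Word n, g (v + (f a + c + f b)) := expect_comm _ _ _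
    _ = 𝔼 _f : A → Word n, 𝔼 v : Word n, g v :=
        expect_congr rfl fun f _ =>
          Fintype.expect_equiv (Equiv.addRight (f a + c + f b)) _ _ fun _ => rfl
    _ = _ := Fintype.expect_const _

lemma card_word (n : ℕ) : (Fintype.card (Word n) : ℝ) = 2 ^ n := by
  simp [Word, ZMod.card]

lemma expect_word_noise (ε : ℝ) (n : ℕ) : 𝔼 v : Word n, noise ε v = 1 / 2 ^ n := by
  rw [Fintype.expect_eq_sum_div_card, sum_noise, card_word]

/-! ### Maximum-likelihood decoding -/

variable {n M L : ℕ}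

lemma card_other_messages [NeZero M] (w : Fin M) :
    ((univ.filter fun m : Fin M × Fin L => m.1 ≠ w).card : ℝ) = ((M : ℝ) - 1) * L := by
  have : (univ.filter fun m : Fin M × Fin L => m.1 ≠ w) = ({w}ᶜ : Finset (Fin M)) ×ˢ univ := by
    ext m; simp
  rw [this, card_product, card_compl, card_univ, Fintype.card_fin, Fintype.card_fin,
    card_singleton, Nat.cast_mul, Nat.cast_sub (NeZero.one_le), Nat.cast_one]

section Decoder

variable [NeZero M] [NeZero L]

/-- The codebook entry that is most likely to have been sent. -/
noncomputable def mlEntry (ε : ℝ) (f : Fin M × Fin L → Word n) (y : Word n) : Fin M × Fin L :=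
  (Finite.exists_max fun m => noise ε (y + f m)).choose

lemma noise_le_noise_mlEntry (ε : ℝ) (f : Fin M × Fin L → Word n) (y : Word n)
    (m : Fin M × Fin L) : noise ε (y + f m) ≤ noise ε (y + f (mlEntry ε f y)) :=
  (Finite.exists_max fun m => noise ε (y + f m)).choose_spec m

/-- The probability that the message of the most likely codebook entry is not the sent one. -/
noncomputable def missProb (ε : ℝ) (f : Fin M × Fin L → Word n) : ℝ :=
  𝔼 m, ∑ e, noise ε e * if (mlEntry ε f (f m + e)).1 ≠ m.1 then 1 else 0

lemma missProb_nonneg {ε : ℝ} (h0 : 0 ≤ ε) (h1 : ε < 1 / 2) (f : Fin M × Fin L → Word n) :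
    0 ≤ missProb ε f :=
  expect_nonneg fun m _ => sum_nonneg fun e _ =>
    mul_nonneg (noise_nonneg h0 h1 e) (by split_ifs <;> norm_num)

/-- Union bound: a wrong row can win only through an entry at least as likely as the sent one, whose
likelihood is `noise ε e`. -/
lemma miss_indicator_le (ε : ℝ) (f : Fin M × Fin L → Word n) (m : Fin M × Fin L) (e : Word n) :
    (if (mlEntry ε f (f m + e)).1 ≠ m.1 then (1 : ℝ) else 0) ≤
      ∑ m' with m'.1 ≠ m.1, if noise ε e ≤ noise ε (f m + e + f m') then 1 else 0 := by
  split_ifs with hm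
  · have hle := noise_le_noise_mlEntry ε f (f m + e) m
    rw [word_add_cancel] at hle
    have := single_le_sum (s := univ.filter fun m' : Fin M × Fin L => m'.1 ≠ m.1)
      (f := fun m' => if noise ε e ≤ noise ε (f m + e + f m') then (1 : ℝ) else 0)
      (fun i _ => by split_ifs <;> norm_num) (mem_filter.2 ⟨mem_univ _, hm⟩)
    simpa [hle] using this
  · exact sum_nonneg fun i _ => by split_ifs <;> norm_num

/-- Markov's inequality, the mean of `noise ε` over all words being `2 ^ (-n)`. -/
lemma expect_word_indicator_le {ε : ℝ} (h0 : 0 ≤ ε) (h1 : ε < 1 / 2) {e : Word n}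
    (he : 0 < noise ε e) :
    𝔼 v : Word n, (if noise ε e ≤ noise ε v then (1 : ℝ) else 0) ≤ 1 / 2 ^ n / noise ε e := by
  rw [← expect_word_noise ε n, expect_div]
  refine expect_le_expect fun v _ => ?_
  split_ifs with hv
  · rwa [one_le_div he]
  · exact div_nonneg (noise_nonneg h0 h1 v) he.le

/-- Only entries of other rows count as errors, hence `M - 1`: a user with a single message may have
an arbitrarily large codebook, as jamming requires. -/
lemma expect_missProb_le {ε : ℝ} (h0 : 0 ≤ ε) (h1 : ε < 1 / 2) :
    𝔼 f : Fin M × Fin L → Word n, missProb ε f ≤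
      ∑ e : Word n, noise ε e * min 1 (((M : ℝ) - 1) * L / 2 ^ n / noise ε e) := by
  unfold missProb
  rw [expect_comm]
  refine expect_le univ_nonempty fun m _ => ?_
  rw [expect_sum_comm]
  refine sum_le_sum fun e _ => ?_
  rw [← mul_expect]
  rcases eq_or_ne (noise ε e) 0 with he | he
  · simp [he]
  have hpos : 0 < noise ε e := lt_of_le_of_ne (noise_nonneg h0 h1 e) he.symm
  refine mul_le_mul_of_nonneg_left (le_min ?_ ?_) hpos.le
  · exact expect_le univ_nonempty fun f _ => by split_ifs <;> norm_num
  · calc 𝔼 f : Fin M × Fin L → Word n, (if (mlEntry ε f (f m + e)).1 ≠ m.1 then (1 : ℝ) else 0)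
        ≤ 𝔼 f : Fin M × Fin L → Word n, ∑ m' with m'.1 ≠ m.1,
            (if noise ε e ≤ noise ε (f m + e + f m') then (1 : ℝ) else 0) :=
          expect_le_expect fun f _ => miss_indicator_le ε f m e
      _ = ∑ m' : Fin M × Fin L with m'.1 ≠ m.1, 𝔼 v : Word n,
            (if noise ε e ≤ noise ε v then (1 : ℝ) else 0) := by
          rw [expect_sum_comm]
          refine sum_congr rfl fun m' hm' => ?_
          exact expect_codebook (fun v => if noise ε e ≤ noise ε v then (1 : ℝ) else 0)
            (fun hmm => (mem_filter.1 hm').2 (by rw [hmm])) e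
      _ ≤ ((M : ℝ) - 1) * L / 2 ^ n / noise ε e := by
          rw [sum_const, nsmul_eq_mul, card_other_messages]
          calc _ ≤ ((M : ℝ) - 1) * L * (1 / 2 ^ n / noise ε e) := by
                refine mul_le_mul_of_nonneg_left (expect_word_indicator_le h0 h1 hpos) ?_
                rw [← card_other_messages m.1]
                positivity
            _ = _ := by ring

end Decoder

/-! ### The word seen by the eavesdropper -/

section Eavesdropper

variable {M₁ L₁ M₂ L₂ : ℕ}

/-- The law of the eavesdropper's word given the messages. -/
noncomputable def outLaw (ε : ℝ) (f₁ : Fin M₁ × Fin L₁ → Word n) (f₂ : Fin M₂ × Fin L₂ → Word n)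
    (w : Fin M₁ × Fin M₂) (z : Word n) : ℝ :=
  𝔼 r : Fin L₁ × Fin L₂, noise ε (z + (f₁ (w.1, r.1) + f₂ (w.2, r.2)))

/-- The average divergence of the eavesdropper's word, given the messages, from a uniform word. -/
noncomputable def leakage (ε : ℝ) (f₁ : Fin M₁ × Fin L₁ → Word n)
    (f₂ : Fin M₂ × Fin L₂ → Word n) : ℝ :=
  𝔼 w, ∑ z, outLaw ε f₁ f₂ w z * Real.logb 2 (2 ^ n * outLaw ε f₁ f₂ w z)

lemma outLaw_nonneg {ε : ℝ} (h0 : 0 ≤ ε) (h1 : ε < 1 / 2) (f₁ : Fin M₁ × Fin L₁ → Word n)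
    (f₂ : Fin M₂ × Fin L₂ → Word n) (w : Fin M₁ × Fin M₂) (z : Word n) :
    0 ≤ outLaw ε f₁ f₂ w z :=
  expect_nonneg fun _ _ => noise_nonneg h0 h1 _

lemma sum_word_add_right (g : Word n → ℝ) (c : Word n) : ∑ z, g (z + c) = ∑ z, g z :=
  Fintype.sum_equiv (Equiv.addRight c) _ _ fun _ => rfl

lemma sum_outLaw [NeZero L₁] [NeZero L₂] (ε : ℝ) (f₁ : Fin M₁ × Fin L₁ → Word n)
    (f₂ : Fin M₂ × Fin L₂ → Word n) (w : Fin M₁ × Fin M₂) : ∑ z, outLaw ε f₁ f₂ w z = 1 := by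
  unfold outLaw
  rw [← expect_sum_comm]
  simp_rw [sum_word_add_right (noise ε), sum_noise, Fintype.expect_const]

/-- Substituting `z = x₁ + x₂ + e` fixes the columns and the noise, so that the codebooks are the
only randomness left inside `g` when Jensen's inequality is applied. -/
lemma sum_outLaw_mul (ε : ℝ) (f₁ : Fin M₁ × Fin L₁ → Word n)
    (f₂ : Fin M₂ × Fin L₂ → Word n) (w : Fin M₁ × Fin M₂) (g : Word n → ℝ) :
    ∑ z, outLaw ε f₁ f₂ w z * g z =
      𝔼 r : Fin L₁ × Fin L₂, ∑ e, noise ε e * g (f₁ (w.1, r.1) + f₂ (w.2, r.2) + e) := by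
  unfold outLaw
  simp_rw [expect_mul]
  rw [← expect_sum_comm]
  refine expect_congr rfl fun r _ => ?_
  rw [← sum_word_add_right (fun e => noise ε e * g (f₁ (w.1, r.1) + f₂ (w.2, r.2) + e))
    (f₁ (w.1, r.1) + f₂ (w.2, r.2))]
  refine sum_congr rfl fun z _ => ?_
  congr 2
  rw [add_comm z, ← add_assoc, word_add_self, zero_add]

/-- The tangent-line form of Jensen's inequality for the logarithm. -/
lemma expect_logb_le {Ω : Type*} [Fintype Ω] [Nonempty Ω] {X : Ω → ℝ} {a : ℝ} (ha : 0 < a)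
    (hX : ∀ ω, 0 < X ω) (hm : 𝔼 ω, X ω ≤ a) : 𝔼 ω, Real.logb 2 (X ω) ≤ Real.logb 2 a := by
  have hl : 0 < Real.log 2 := Real.log_pos (by norm_num)
  have key : ∀ ω, Real.logb 2 (X ω) ≤
      (Real.log a - 1) / Real.log 2 + X ω * (1 / (a * Real.log 2)) := by
    intro ω
    have h := Real.log_le_sub_one_of_pos (div_pos (hX ω) ha)
    rw [Real.log_div (hX ω).ne' ha.ne'] at h
    have : (Real.log a - 1) / Real.log 2 + X ω * (1 / (a * Real.log 2)) =
        (Real.log a - 1 + X ω / a) / Real.log 2 := by field_simp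
    rw [this, Real.logb]
    gcongr
    linarith
  calc 𝔼 ω, Real.logb 2 (X ω)
      ≤ 𝔼 ω, ((Real.log a - 1) / Real.log 2 + X ω * (1 / (a * Real.log 2))) :=
        expect_le_expect fun ω _ => key ω
    _ = (Real.log a - 1) / Real.log 2 + (𝔼 ω, X ω) * (1 / (a * Real.log 2)) := by
        rw [expect_add_distrib, Fintype.expect_const, expect_mul]
    _ ≤ (Real.log a - 1) / Real.log 2 + a * (1 / (a * Real.log 2)) := by gcongr
    _ = Real.logb 2 a := by rw [Real.logb]; field_simp; ring

variable [NeZero L₁] [NeZero L₂]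

/-- The mean of the eavesdropper's law over a random pair of codebooks, at the words that a given
noise word produces. -/
lemma expect_outLaw_le (ε : ℝ) (w : Fin M₁ × Fin M₂)
    (r : Fin L₁ × Fin L₂) (e : Word n) :
    𝔼 f : (Fin M₁ × Fin L₁ → Word n) × (Fin M₂ × Fin L₂ → Word n),
        2 ^ n * outLaw ε f.1 f.2 w (f.1 (w.1, r.1) + f.2 (w.2, r.2) + e) ≤
      1 + 2 ^ n / (L₁ * L₂) * noise ε e := by
  have term : ∀ r' : Fin L₁ × Fin L₂,
      𝔼 f : (Fin M₁ × Fin L₁ → Word n) × (Fin M₂ × Fin L₂ → Word n),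
        noise ε (f.1 (w.1, r.1) + f.2 (w.2, r.2) + e + (f.1 (w.1, r'.1) + f.2 (w.2, r'.2))) ≤
      1 / 2 ^ n + if r' = r then noise ε e else 0 := by
    intro r'
    rw [← univ_product_univ, expect_product]
    split_ifs with hr
    · subst hr
      simp_rw [word_add_cancel, Fintype.expect_const]
      have : (0 : ℝ) ≤ 1 / 2 ^ n := by positivity
      linarith
    · rw [add_zero, ← expect_word_noise ε n]
      refine le_of_eq ?_
      -- Two column pairs may agree in one coordinate; the codebook in which they differ alone makes
      -- the argument uniform, the other one being held fixed.
      by_cases hr1 : r'.1 = r.1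
      · have hr2 : r.2 ≠ r'.2 := fun h => hr (Prod.ext hr1 h.symm)
        calc _ = 𝔼 _f₁ : Fin M₁ × Fin L₁ → Word n, 𝔼 v : Word n, noise ε v := by
              refine expect_congr rfl fun f₁ _ => ?_
              rw [← expect_codebook (noise ε) (a := (w.2, r.2)) (b := (w.2, r'.2))
                (fun h => hr2 (Prod.ext_iff.1 h).2) (f₁ (w.1, r.1) + e + f₁ (w.1, r'.1))]
              refine expect_congr rfl fun f₂ _ => ?_
              congr 1
              dsimp only
              abel
          _ = _ := Fintype.expect_const _
      · rw [expect_comm]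
        calc _ = 𝔼 _f₂ : Fin M₂ × Fin L₂ → Word n, 𝔼 v : Word n, noise ε v := by
              refine expect_congr rfl fun f₂ _ => ?_
              rw [← expect_codebook (noise ε) (a := (w.1, r.1)) (b := (w.1, r'.1))
                (fun h => hr1 (Prod.ext_iff.1 h).2.symm) (f₂ (w.2, r.2) + e + f₂ (w.2, r'.2))]
              refine expect_congr rfl fun f₁ _ => ?_
              congr 1
              dsimp only
              abel
          _ = _ := Fintype.expect_const _
  unfold outLaw
  rw [← mul_expect, expect_comm]
  calc _ ≤ 2 ^ n * 𝔼 r' : Fin L₁ × Fin L₂, (1 / 2 ^ n + if r' = r then noise ε e else 0) := by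
        gcongr with r'
        exact term r'
    _ = _ := by
        rw [expect_add_distrib, Fintype.expect_const, Fintype.expect_eq_sum_div_card,
          sum_ite_eq' univ r, if_pos (mem_univ r), Fintype.card_prod, Fintype.card_fin,
          Fintype.card_fin]
        push_cast
        field_simp

/-- Soft covering: with columns and noise fixed, Jensen moves the codebook average inside the
logarithm. There the pair actually sent contributes the `noise ε e` term, and all other pairs
together at most the `1` of a uniform output. -/
lemma expect_leakage_le [NeZero M₁] [NeZero M₂] {ε : ℝ} (h0 : 0 ≤ ε) (h1 : ε < 1 / 2) :
    𝔼 f : (Fin M₁ × Fin L₁ → Word n) × (Fin M₂ × Fin L₂ → Word n), leakage ε f.1 f.2 ≤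
      ∑ e : Word n, noise ε e * Real.logb 2 (1 + 2 ^ n / (L₁ * L₂) * noise ε e) := by
  unfold leakage
  rw [expect_comm]
  refine expect_le univ_nonempty fun w _ => ?_
  simp_rw [sum_outLaw_mul]
  rw [expect_comm]
  refine expect_le univ_nonempty fun r _ => ?_
  rw [expect_sum_comm]
  refine sum_le_sum fun e _ => ?_
  rw [← mul_expect]
  rcases eq_or_ne (noise ε e) 0 with he | he
  · simp [he]
  have hpos : 0 < noise ε e := lt_of_le_of_ne (noise_nonneg h0 h1 e) he.symm
  refine mul_le_mul_of_nonneg_left ?_ hpos.le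
  refine expect_logb_le (by positivity) (fun f => ?_) (expect_outLaw_le ε w r e)
  refine mul_pos (by positivity) (expect_pos' (fun _ _ => noise_nonneg h0 h1 _) ⟨r, mem_univ r, ?_⟩)
  rwa [word_add_cancel]

end Eavesdropper

end BATW

namespace BATW

open Finset
open scoped BigOperators

/-! ### Entropy -/

/-- The divergence of a law on a finite set from the uniform law is nonnegative. -/
lemma sum_mul_logb_card_mul_nonneg {β : Type*} [Fintype β] {p : β → ℝ} (hp : ∀ b, 0 ≤ p b)
    (hs : ∑ b, p b = 1) : 0 ≤ ∑ b, p b * Real.logb 2 (Fintype.card β * p b) := by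
  have hl : 0 < Real.log 2 := Real.log_pos (by norm_num)
  rcases isEmpty_or_nonempty β with hβ | hβ
  · simp
  have hc : (0 : ℝ) < Fintype.card β := by exact_mod_cast Fintype.card_pos
  -- From `1 - 1 / x ≤ log x`; these lower bounds sum to zero.
  have key : ∀ b, (p b - 1 / Fintype.card β) / Real.log 2 ≤
      p b * Real.logb 2 (Fintype.card β * p b) := by
    intro b
    rcases eq_or_lt_of_le (hp b) with h | h
    · rw [← h]
      simp only [zero_sub, zero_mul]
      exact div_nonpos_of_nonpos_of_nonneg (by simp) hl.le
    · have hlog := Real.one_sub_inv_le_log_of_pos (mul_pos hc h)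
      rw [Real.logb, ← mul_div_assoc]
      gcongr
      calc p b - 1 / Fintype.card β = p b * (1 - (Fintype.card β * p b)⁻¹) := by field_simp
        _ ≤ _ := by gcongr
  refine le_trans (le_of_eq ?_) (sum_le_sum fun b _ => key b)
  rw [← sum_div, sum_sub_distrib, hs, sum_const, card_univ, nsmul_eq_mul, mul_one_div_cancel hc.ne',
    sub_self, zero_div]

/-- For a uniform input, the equivocation falls short of the input entropy by at most the average
divergence of the output from a uniform output. -/
lemma le_condEntropy_of_uniform {α β : Type*} [Fintype α] [Fintype β] [Nonempty α] [Nonempty β]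
    {q : α → β → ℝ} (hq : ∀ a b, 0 ≤ q a b) (hs : ∀ a, ∑ b, q a b = 1) :
    Real.logb 2 (Fintype.card α) -
        𝔼 a, ∑ b, q a b * Real.logb 2 (Fintype.card β * q a b) ≤
      condEntropy fun a b => 1 / (Fintype.card α : ℝ) * q a b := by
  have hα : (0 : ℝ) < Fintype.card α := by exact_mod_cast Fintype.card_pos
  have hβ : (0 : ℝ) < Fintype.card β := by exact_mod_cast Fintype.card_pos
  set p : α → β → ℝ := fun a b => 1 / (Fintype.card α : ℝ) * q a b with hp
  set P : β → ℝ := fun b => ∑ a, p a b with hP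
  have hp0 : ∀ a b, 0 ≤ p a b := fun a b => mul_nonneg (by positivity) (hq a b)
  have hP0 : ∀ b, 0 ≤ P b := fun b => sum_nonneg fun a _ => hp0 a b
  have hp1 : ∑ a, ∑ b, p a b = 1 := by
    simp_rw [hp, ← mul_sum, hs, sum_const, card_univ, nsmul_eq_mul, mul_one]
    field_simp
  have hP1 : ∑ b, P b = 1 := by rw [hP, sum_comm]; exact hp1
  -- Summed, this says that the mean divergence of the conditional laws from uniform is the mutual
  -- information plus the divergence of the marginal `P`; the latter is nonnegative and is dropped.
  have term : ∀ a b, p a b * Real.logb 2 (p a b / P b) =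
      1 / (Fintype.card α : ℝ) * (q a b * Real.logb 2 (Fintype.card β * q a b)) -
        p a b * Real.logb 2 (Fintype.card α) -
        p a b * Real.logb 2 (Fintype.card β * P b) := by
    intro a b
    rcases eq_or_lt_of_le (hq a b) with h | h
    · simp [hp, ← h]
    · have hpab : 0 < p a b := by simp only [hp]; positivity
      have hPb : 0 < P b := hpab.trans_le (single_le_sum (fun a' _ => hp0 a' b) (mem_univ a))
      have e : p a b / P b =
          Fintype.card β * q a b / Fintype.card α / (Fintype.card β * P b) := by
        simp only [hp]; field_simp
      rw [e, Real.logb_div (by positivity) (by positivity),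
        Real.logb_div (by positivity) (by positivity)]
      simp only [hp]
      ring
  have h3 : ∑ a, ∑ b, p a b * Real.logb 2 (Fintype.card β * P b) =
      ∑ b, P b * Real.logb 2 (Fintype.card β * P b) := by
    rw [sum_comm]; simp_rw [← sum_mul]; rfl
  have h2 : ∑ a, ∑ b, p a b * Real.logb 2 (Fintype.card α) = Real.logb 2 (Fintype.card α) := by
    simp_rw [← sum_mul, hp1, one_mul]
  have h1 : ∑ a, ∑ b, 1 / (Fintype.card α : ℝ) * (q a b * Real.logb 2 (Fintype.card β * q a b)) =
      𝔼 a, ∑ b, q a b * Real.logb 2 (Fintype.card β * q a b) := by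
    simp_rw [← mul_sum, Fintype.expect_eq_sum_div_card]; ring
  have hg := sum_mul_logb_card_mul_nonneg hP0 hP1
  change _ ≤ -∑ a, ∑ b, p a b * Real.logb 2 (p a b / P b)
  simp_rw [term, sum_sub_distrib, h1, h2, h3]
  linarith

lemma leakage_nonneg {n M₁ L₁ M₂ L₂ : ℕ} [NeZero L₁] [NeZero L₂] {ε : ℝ} (h0 : 0 ≤ ε) (h1 : ε < 1 / 2)
    (f₁ : Fin M₁ × Fin L₁ → Word n) (f₂ : Fin M₂ × Fin L₂ → Word n) : 0 ≤ leakage ε f₁ f₂ := by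
  refine expect_nonneg fun w _ => ?_
  rw [← card_word]
  exact sum_mul_logb_card_mul_nonneg (outLaw_nonneg h0 h1 f₁ f₂ w) (sum_outLaw ε f₁ f₂ w)

lemma expect_fst {A B : Type*} [Fintype A] [Fintype B] [Nonempty B] (g : A → ℝ) :
    𝔼 r : A × B, g r.1 = 𝔼 a, g a := by
  rw [← univ_product_univ, expect_product]
  exact expect_congr rfl fun a _ => Fintype.expect_const (ι := B) (g a)

lemma expect_snd {A B : Type*} [Fintype A] [Fintype B] [Nonempty A] (g : B → ℝ) :
    𝔼 r : A × B, g r.2 = 𝔼 b, g b := by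
  rw [← univ_product_univ, expect_product]
  exact Fintype.expect_const (ι := A) (𝔼 b, g b)

lemma missProb_eq {n M L : ℕ} [NeZero M] [NeZero L] (ε : ℝ) (f : Fin M × Fin L → Word n) :
    missProb ε f =
      𝔼 w, 𝔼 r, ∑ e, noise ε e * if (mlEntry ε f (f (w, r) + e)).1 ≠ w then 1 else 0 := by
  unfold missProb
  rw [← univ_product_univ, expect_product]

/-! ### The code of a pair of codebooks -/

/-- Averaging over the word sent by an encoder that picks a codebook entry uniformly. -/
lemma sum_map_uniform_mul {A B : Type*} [Fintype A] [Nonempty A] [Fintype B] (g : A → B)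
    (F : B → ℝ) :
    ∑ x, (((PMF.uniformOfFintype A).map g) x).toReal * F x = 𝔼 r, F (g r) := by
  classical
  have hx : ∀ x, (((PMF.uniformOfFintype A).map g) x).toReal =
      ∑ r, if x = g r then (Fintype.card A : ℝ)⁻¹ else 0 := by
    intro x
    rw [PMF.map_apply, tsum_fintype, ENNReal.toReal_sum]
    · refine sum_congr rfl fun r _ => ?_
      by_cases h : x = g r <;> simp [h]
    · intro r _
      split_ifs
      · exact PMF.apply_ne_top _ _
      · exact ENNReal.zero_ne_top
  simp_rw [hx, sum_mul]
  rw [sum_comm, Fintype.expect_eq_sum_div_card, sum_div]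
  refine sum_congr rfl fun r _ => ?_
  simp [ite_mul]
  ring

variable {n M₁ L₁ M₂ L₂ : ℕ} [NeZero M₁] [NeZero L₁] [NeZero M₂] [NeZero L₂]

/-- The code in which user `k` sends a uniformly chosen one of the `L_k` codebook entries that
belong to its message, and each receiver subtracts its own word before decoding. -/
noncomputable abbrev codeOf (ε₁ ε₂ : ℝ) (f₁ : Fin M₁ × Fin L₁ → Word n)
    (f₂ : Fin M₂ × Fin L₂ → Word n) : Code n where
  M₁ := M₁
  M₂ := M₂
  M₁_pos := NeZero.pos M₁
  M₂_pos := NeZero.pos M₂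
  enc₁ w := (PMF.uniformOfFintype (Fin L₁)).map fun r => f₁ (w, r)
  enc₂ w := (PMF.uniformOfFintype (Fin L₂)).map fun r => f₂ (w, r)
  dec₁ x₁ y := (mlEntry ε₁ f₂ (y + x₁)).1
  dec₂ x₂ y := (mlEntry ε₂ f₁ (y + x₂)).1

variable (ε₁ ε₂ εW : ℝ) (f₁ : Fin M₁ × Fin L₁ → Word n) (f₂ : Fin M₂ × Fin L₂ → Word n)

/-- The probability of an event, given the messages, is an average over codebook entries. -/
lemma sum_condLaw_codeOf (w : Fin M₁ × Fin M₂) (P : Word n → Word n → Word n → Word n → Word n → Prop)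
    [∀ x₁ x₂ e₁ e₂ e₃, Decidable (P x₁ x₂ e₁ e₂ e₃)] :
    (∑ x₁, ∑ x₂, ∑ e₁, ∑ e₂, ∑ e₃, if P x₁ x₂ e₁ e₂ e₃ then
        (codeOf ε₁ ε₂ f₁ f₂).condLaw ε₁ ε₂ εW w x₁ x₂ e₁ e₂ e₃ else 0) =
      𝔼 r : Fin L₁ × Fin L₂, ∑ e₁, ∑ e₂, ∑ e₃,
        if P (f₁ (w.1, r.1)) (f₂ (w.2, r.2)) e₁ e₂ e₃ then
          noise ε₁ e₁ * noise ε₂ e₂ * noise εW e₃ else 0 := by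
  rw [← univ_product_univ, expect_product]
  dsimp only
  rw [← sum_map_uniform_mul (fun r => f₁ (w.1, r)) fun x₁ => 𝔼 r₂, ∑ e₁, ∑ e₂, ∑ e₃,
        if P x₁ (f₂ (w.2, r₂)) e₁ e₂ e₃ then noise ε₁ e₁ * noise ε₂ e₂ * noise εW e₃ else 0]
  refine sum_congr rfl fun x₁ _ => ?_
  rw [← sum_map_uniform_mul (fun r => f₂ (w.2, r)) fun x₂ => ∑ e₁, ∑ e₂, ∑ e₃,
        if P x₁ x₂ e₁ e₂ e₃ then noise ε₁ e₁ * noise ε₂ e₂ * noise εW e₃ else 0]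
  simp_rw [mul_sum]
  refine sum_congr rfl fun x₂ _ => sum_congr rfl fun e₁ _ => sum_congr rfl fun e₂ _ =>
    sum_congr rfl fun e₃ _ => ?_
  split_ifs
  · simp only [Code.condLaw, codeOf]
    ring
  · simp

lemma tapLaw_codeOf (w : Fin M₁ × Fin M₂) (z : Word n) :
    (codeOf ε₁ ε₂ f₁ f₂).tapLaw ε₁ ε₂ εW w z =
      1 / (Fintype.card (Fin M₁ × Fin M₂) : ℝ) * outLaw εW f₁ f₂ w z := by
  have hcond : ∀ x e : Word n, x + e = z ↔ e = z + x := by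
    intro x e
    constructor
    · rintro rfl; exact (word_add_cancel x e).symm
    · rintro rfl; rw [← add_assoc, word_add_cancel]
  unfold Code.tapLaw
  rw [sum_condLaw_codeOf ε₁ ε₂ εW f₁ f₂ w fun x₁ x₂ _ _ e₃ => x₁ + x₂ + e₃ = z]
  have hsum : ∀ x : Word n, (∑ e₁ : Word n, ∑ e₂ : Word n, ∑ e₃ : Word n,
      if x + e₃ = z then noise ε₁ e₁ * noise ε₂ e₂ * noise εW e₃ else 0) = noise εW (z + x) := by
    intro x
    simp_rw [hcond, sum_ite_eq', mem_univ, if_true, ← sum_mul, ← mul_sum, sum_noise, mul_one,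
      sum_noise, one_mul]
  simp_rw [hsum]
  simp [Code.msgLaw, outLaw]

lemma sum_noise_or_le {ε₁ ε₂ εW : ℝ} (h0₁ : 0 ≤ ε₁) (h1₁ : ε₁ < 1 / 2) (h0₂ : 0 ≤ ε₂)
    (h1₂ : ε₂ < 1 / 2) (h0W : 0 ≤ εW) (h1W : εW < 1 / 2) (P Q : Word n → Prop)
    [DecidablePred P] [DecidablePred Q] (R : Word n → Word n → Prop)
    [∀ e₁ e₂, Decidable (R e₁ e₂)] (hR : ∀ e₁ e₂, R e₁ e₂ → Q e₂ ∨ P e₁) :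
    (∑ e₁ : Word n, ∑ e₂ : Word n, ∑ e₃ : Word n,
        if R e₁ e₂ then noise ε₁ e₁ * noise ε₂ e₂ * noise εW e₃ else 0) ≤
      (∑ e, noise ε₂ e * if Q e then 1 else 0) + ∑ e, noise ε₁ e * if P e then 1 else 0 := by
  have key : ∀ e₁ e₂ e₃ : Word n,
      (if R e₁ e₂ then noise ε₁ e₁ * noise ε₂ e₂ * noise εW e₃ else 0) ≤
        noise ε₁ e₁ * (noise ε₂ e₂ * if Q e₂ then 1 else 0) * noise εW e₃ +
          (noise ε₁ e₁ * if P e₁ then 1 else 0) * noise ε₂ e₂ * noise εW e₃ := by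
    intro e₁ e₂ e₃
    have := noise_nonneg h0₁ h1₁ e₁
    have := noise_nonneg h0₂ h1₂ e₂
    have := noise_nonneg h0W h1W e₃
    have hpos : 0 ≤ noise ε₁ e₁ * noise ε₂ e₂ * noise εW e₃ := by positivity
    by_cases hr : R e₁ e₂
    · rcases hR e₁ e₂ hr with hq | hp
      · by_cases hp : P e₁ <;> simp [hr, hq, hp, hpos]
      · by_cases hq : Q e₂ <;> simp [hr, hq, hp, hpos]
    · rw [if_neg hr]
      split_ifs <;> positivity
  refine (sum_le_sum fun e₁ _ => sum_le_sum fun e₂ _ => sum_le_sum fun e₃ _ =>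
    key e₁ e₂ e₃).trans (le_of_eq ?_)
  simp_rw [sum_add_distrib, ← mul_sum, sum_noise, mul_one, ← mul_sum, ← sum_mul, sum_noise,
    one_mul, mul_one]

/-- Adding its own word leaves each receiver with the other user's codeword plus noise; a union
bound over the two receivers does the rest. -/
lemma errorProb_codeOf_le {ε₁ ε₂ εW : ℝ} (h0₁ : 0 ≤ ε₁) (h1₁ : ε₁ < 1 / 2) (h0₂ : 0 ≤ ε₂)
    (h1₂ : ε₂ < 1 / 2) (h0W : 0 ≤ εW) (h1W : εW < 1 / 2) :
    (codeOf ε₁ ε₂ f₁ f₂).errorProb ε₁ ε₂ εW ≤ missProb ε₂ f₁ + missProb ε₁ f₂ := by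
  have cancel₁ : ∀ x₁ x₂ e : Word n, x₁ + x₂ + e + x₁ = x₂ + e := fun x₁ x₂ e => by
    rw [add_assoc x₁, word_add_cancel]
  have cancel₂ : ∀ x₁ x₂ e : Word n, x₁ + x₂ + e + x₂ = x₁ + e := fun x₁ x₂ e => by
    rw [add_comm x₁, cancel₁]
  have hw : ∀ w : Fin M₁ × Fin M₂, (∑ x₁, ∑ x₂, ∑ e₁, ∑ e₂, ∑ e₃,
      if (codeOf ε₁ ε₂ f₁ f₂).decode x₁ x₂ e₁ e₂ ≠ w then
        (codeOf ε₁ ε₂ f₁ f₂).condLaw ε₁ ε₂ εW w x₁ x₂ e₁ e₂ e₃ else 0) ≤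
      (𝔼 r, ∑ e, noise ε₂ e * if (mlEntry ε₂ f₁ (f₁ (w.1, r) + e)).1 ≠ w.1 then 1 else 0) +
        𝔼 r, ∑ e, noise ε₁ e * if (mlEntry ε₁ f₂ (f₂ (w.2, r) + e)).1 ≠ w.2 then 1 else 0 := by
    intro w
    rw [sum_condLaw_codeOf ε₁ ε₂ εW f₁ f₂ w
      fun x₁ x₂ e₁ e₂ _ => (codeOf ε₁ ε₂ f₁ f₂).decode x₁ x₂ e₁ e₂ ≠ w]
    refine (expect_le_expect fun r _ => sum_noise_or_le h0₁ h1₁ h0₂ h1₂ h0W h1W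
      (fun e => (mlEntry ε₁ f₂ (f₂ (w.2, r.2) + e)).1 ≠ w.2)
      (fun e => (mlEntry ε₂ f₁ (f₁ (w.1, r.1) + e)).1 ≠ w.1) _ ?_).trans (le_of_eq ?_)
    · intro e₁ e₂ h
      by_contra! hc
      refine h (Prod.ext ?_ ?_)
      · change (mlEntry ε₂ f₁ (f₁ (w.1, r.1) + f₂ (w.2, r.2) + e₂ + f₂ (w.2, r.2))).1 = w.1
        rw [cancel₂]
        exact hc.1
      · change (mlEntry ε₁ f₂ (f₁ (w.1, r.1) + f₂ (w.2, r.2) + e₁ + f₁ (w.1, r.1))).1 = w.2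
        rw [cancel₁]
        exact hc.2
    · rw [expect_add_distrib]
      exact congrArg₂ (· + ·)
        (expect_fst fun r => ∑ e, noise ε₂ e *
          if (mlEntry ε₂ f₁ (f₁ (w.1, r) + e)).1 ≠ w.1 then 1 else 0)
        (expect_snd fun r => ∑ e, noise ε₁ e *
          if (mlEntry ε₁ f₂ (f₂ (w.2, r) + e)).1 ≠ w.2 then 1 else 0)
  have havg : (codeOf ε₁ ε₂ f₁ f₂).errorProb ε₁ ε₂ εW =
      𝔼 w : Fin M₁ × Fin M₂, ∑ x₁, ∑ x₂, ∑ e₁, ∑ e₂, ∑ e₃,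
        if (codeOf ε₁ ε₂ f₁ f₂).decode x₁ x₂ e₁ e₂ ≠ w then
          (codeOf ε₁ ε₂ f₁ f₂).condLaw ε₁ ε₂ εW w x₁ x₂ e₁ e₂ e₃ else 0 := by
    rw [Fintype.expect_eq_sum_div_card, Fintype.card_prod, Fintype.card_fin, Fintype.card_fin,
      Nat.cast_mul, div_eq_inv_mul, ← one_div]
    rfl
  rw [havg]
  refine (expect_le_expect fun w _ => hw w).trans (le_of_eq ?_)
  rw [expect_add_distrib, missProb_eq, missProb_eq]
  exact congrArg₂ (· + ·)
    (expect_fst fun w => 𝔼 r, ∑ e, noise ε₂ e *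
      if (mlEntry ε₂ f₁ (f₁ (w, r) + e)).1 ≠ w then 1 else 0)
    (expect_snd fun w => 𝔼 r, ∑ e, noise ε₁ e *
      if (mlEntry ε₁ f₂ (f₂ (w, r) + e)).1 ≠ w then 1 else 0)

lemma entropy_msgLaw_codeOf :
    entropy (codeOf ε₁ ε₂ f₁ f₂).msgLaw = Real.logb 2 ((M₁ : ℝ) * M₂) := by
  have h₁ : (M₁ : ℝ) ≠ 0 := Nat.cast_ne_zero.2 (NeZero.ne M₁)
  have h₂ : (M₂ : ℝ) ≠ 0 := Nat.cast_ne_zero.2 (NeZero.ne M₂)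
  simp only [entropy, Code.msgLaw, codeOf, sum_const, card_univ, Fintype.card_prod,
    Fintype.card_fin, nsmul_eq_mul, Nat.cast_mul, one_div, Real.logb_inv]
  field_simp

lemma le_condEntropy_codeOf {εW : ℝ} (h0W : 0 ≤ εW) (h1W : εW < 1 / 2) :
    Real.logb 2 ((M₁ : ℝ) * M₂) - leakage εW f₁ f₂ ≤
      condEntropy ((codeOf ε₁ ε₂ f₁ f₂).tapLaw ε₁ ε₂ εW) := by
  have h := le_condEntropy_of_uniform (outLaw_nonneg h0W h1W f₁ f₂) (sum_outLaw εW f₁ f₂)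
  have htap : (codeOf ε₁ ε₂ f₁ f₂).tapLaw ε₁ ε₂ εW = fun w z =>
      1 / (Fintype.card (Fin M₁ × Fin M₂) : ℝ) * outLaw εW f₁ f₂ w z :=
    funext fun w => funext fun z => tapLaw_codeOf ε₁ ε₂ εW f₁ f₂ w z
  rw [htap]
  refine le_trans (le_of_eq ?_) h
  simp [leakage, ZMod.card]

end BATW

namespace BATW

open Finset
open scoped BigOperators Topology

/-! ### Existence of good codes -/

lemma exists_codebooks {n M₁ L₁ M₂ L₂ : ℕ} [NeZero M₁] [NeZero L₁] [NeZero M₂] [NeZero L₂]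
    {ε₁ ε₂ εW : ℝ} (h0₁ : 0 ≤ ε₁) (h1₁ : ε₁ < 1 / 2) (h0₂ : 0 ≤ ε₂) (h1₂ : ε₂ < 1 / 2)
    (h0W : 0 ≤ εW) (h1W : εW < 1 / 2) {δ κ a b c : ℝ} (hδ : 0 < δ) (hκ : 0 < κ)
    (ha : 𝔼 f : Fin M₁ × Fin L₁ → Word n, missProb ε₂ f ≤ a)
    (hb : 𝔼 f : Fin M₂ × Fin L₂ → Word n, missProb ε₁ f ≤ b)
    (hc : 𝔼 f : (Fin M₁ × Fin L₁ → Word n) × (Fin M₂ × Fin L₂ → Word n),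
      leakage εW f.1 f.2 ≤ c)
    (habc : (a + b) / δ + c / κ ≤ 1) :
    ∃ (f₁ : Fin M₁ × Fin L₁ → Word n) (f₂ : Fin M₂ × Fin L₂ → Word n),
      missProb ε₂ f₁ + missProb ε₁ f₂ ≤ δ ∧ leakage εW f₁ f₂ ≤ κ := by
  -- Scaling both nonnegative criteria by their targets and adding them lets one codebook pair
  -- satisfy both at once.
  have hmean : 𝔼 f : (Fin M₁ × Fin L₁ → Word n) × (Fin M₂ × Fin L₂ → Word n),
      ((missProb ε₂ f.1 + missProb ε₁ f.2) / δ + leakage εW f.1 f.2 / κ) ≤ 1 := by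
    rw [expect_add_distrib, ← expect_div, ← expect_div, expect_add_distrib,
      expect_fst (missProb ε₂), expect_snd (missProb ε₁)]
    refine le_trans ?_ habc
    gcongr
  obtain ⟨⟨f₁, f₂⟩, -, hf⟩ := exists_le_of_expect_le univ_nonempty hmean
  have hm : 0 ≤ (missProb ε₂ f₁ + missProb ε₁ f₂) / δ :=
    div_nonneg (add_nonneg (missProb_nonneg h0₂ h1₂ f₁) (missProb_nonneg h0₁ h1₁ f₂)) hδ.le
  have hl : 0 ≤ leakage εW f₁ f₂ / κ := div_nonneg (leakage_nonneg h0W h1W f₁ f₂) hκ.le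
  dsimp only at hf
  exact ⟨f₁, f₂, (div_le_one hδ).1 (by linarith), (div_le_one hκ).1 (by linarith)⟩

/-- The slack `δ * ρ / 2` makes the linear part of the leakage half of its allowance `δ * (n * ρ)`;
everything else vanishes, so the limit is `1 / 2`. -/
lemma eventually_budget_le_one (V₁ V₂ V : ℝ) {δ η ρ : ℝ} (hδ : 0 < δ) (hη : 0 < η) (hρ : 0 < ρ) :
    ∀ᶠ n : ℕ in atTop,
      ((V₁ / (n * η ^ 2) + 2 * 2 ^ (-(n * η))) + (V₂ / (n * η ^ 2) + 2 * 2 ^ (-(n * η)))) / δ +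
        (1 + V / (δ * ρ / 2) + n * (δ * ρ / 2)) / (δ * (n * ρ)) ≤ 1 := by
  have hn : Tendsto (fun n : ℕ => (n : ℝ)) atTop atTop := tendsto_natCast_atTop_atTop
  have hv : ∀ V : ℝ, Tendsto (fun n : ℕ => V / (n * η ^ 2)) atTop (𝓝 0) := fun V =>
    tendsto_const_nhds.div_atTop (hn.atTop_mul_const (by positivity))
  have he : Tendsto (fun n : ℕ => 2 * (2 : ℝ) ^ (-(n * η))) atTop (𝓝 0) := by
    have h2 : Tendsto (fun n : ℕ => (2 : ℝ) ^ (-(n * η))) atTop (𝓝 0) :=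
      (tendsto_rpow_atBot_of_base_gt_one 2 (by norm_num)).comp
        (tendsto_neg_atTop_atBot.comp (hn.atTop_mul_const hη))
    simpa using h2.const_mul 2
  have hl : Tendsto (fun n : ℕ => (1 + V / (δ * ρ / 2)) / (δ * ρ) / n + 1 / 2) atTop
      (𝓝 (0 + 1 / 2)) := (tendsto_const_nhds.div_atTop hn).add tendsto_const_nhds
  have hlim := ((((hv V₁).add he).add ((hv V₂).add he)).div_const δ).add hl
  filter_upwards [hlim.eventually (eventually_le_nhds (b := 1) (by norm_num)),
    eventually_gt_atTop 0] with n hle hpos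
  have hpos' : (0 : ℝ) < n := by exact_mod_cast hpos
  refine le_trans (le_of_eq ?_) hle
  congr 1
  field_simp

lemma two_rpow_natCast_mul_one_sub (n : ℕ) (x : ℝ) :
    (2 : ℝ) ^ (n * (1 - x)) / 2 ^ n = 2 ^ (-(n * x)) := by
  rw [← Real.rpow_natCast 2 n, ← Real.rpow_sub two_pos]
  congr 1
  ring

/-- Random coding: codes exist as soon as the codebooks are small enough for reliable decoding and
the encoders randomize enough to hide the messages. -/
lemma eventually_exists_code {ε₁ ε₂ εW : ℝ} (h0₁ : 0 ≤ ε₁) (h1₁ : ε₁ < 1 / 2) (h0₂ : 0 ≤ ε₂)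
    (h1₂ : ε₂ < 1 / 2) (h0W : 0 ≤ εW) (h1W : εW < 1 / 2) {δ η ρ : ℝ} (hδ : 0 < δ) (hη : 0 < η)
    (hρ : 0 < ρ) :
    ∀ᶠ n : ℕ in atTop, ∀ M₁ L₁ M₂ L₂ : ℕ, 0 < M₁ → 0 < L₁ → 0 < M₂ → 0 < L₂ →
      ((M₁ : ℝ) - 1) * L₁ ≤ 2 * 2 ^ (n * (1 - (h ε₂ + 2 * η))) →
      ((M₂ : ℝ) - 1) * L₂ ≤ 2 * 2 ^ (n * (1 - (h ε₁ + 2 * η))) →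
      (2 : ℝ) ^ (n * (1 - h εW)) ≤ L₁ * L₂ → (2 : ℝ) ^ (n * ρ) ≤ M₁ * M₂ →
      ∃ c : Code n, c.M₁ = M₁ ∧ c.M₂ = M₂ ∧ c.errorProb ε₁ ε₂ εW ≤ δ ∧
        1 - δ ≤ condEntropy (c.tapLaw ε₁ ε₂ εW) / entropy c.msgLaw := by
  filter_upwards [eventually_budget_le_one (infoVar ε₂) (infoVar ε₁) (infoVar εW) hδ hη hρ,
    eventually_gt_atTop 0] with n hbudget hn M₁ L₁ M₂ L₂ hM₁ hL₁ hM₂ hL₂ hK₁ hK₂ hL hM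
  have hn' : (0 : ℝ) < n := by exact_mod_cast hn
  have : NeZero M₁ := ⟨hM₁.ne'⟩
  have : NeZero L₁ := ⟨hL₁.ne'⟩
  have : NeZero M₂ := ⟨hM₂.ne'⟩
  have : NeZero L₂ := ⟨hL₂.ne'⟩
  have rate : ∀ {K x : ℝ}, K ≤ 2 * 2 ^ (n * (1 - x)) → K / 2 ^ n ≤ 2 * 2 ^ (-(n * x)) := by
    intro K x hK
    rw [← two_rpow_natCast_mul_one_sub, ← mul_div_assoc]
    gcongr
  have hKW : (2 : ℝ) ^ n / (L₁ * L₂) ≤ 2 ^ (n * h εW) := by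
    rw [div_le_comm₀ (by positivity) (by positivity)]
    refine le_trans (le_of_eq ?_) hL
    rw [← Real.rpow_natCast 2 n, ← Real.rpow_sub two_pos]
    congr 1
    ring
  have hθ : 0 < δ * ρ / 2 := by positivity
  obtain ⟨f₁, f₂, hmiss, hleak⟩ := exists_codebooks h0₁ h1₁ h0₂ h1₂ h0W h1W hδ
    (κ := δ * (n * ρ)) (by positivity)
    ((expect_missProb_le h0₂ h1₂ (M := M₁) (L := L₁)).trans
      (sum_noise_mul_min_le h0₂ h1₂ hn hη (rate hK₁)))
    ((expect_missProb_le h0₁ h1₁ (M := M₂) (L := L₂)).trans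
      (sum_noise_mul_min_le h0₁ h1₁ hn hη (rate hK₂)))
    ((expect_leakage_le h0W h1W (M₁ := M₁) (L₁ := L₁) (M₂ := M₂) (L₂ := L₂)).trans
      (sum_noise_mul_logb_le h0W h1W hn hθ (by positivity) hKW))
    hbudget
  refine ⟨codeOf ε₁ ε₂ f₁ f₂, rfl, rfl,
    (errorProb_codeOf_le f₁ f₂ h0₁ h1₁ h0₂ h1₂ h0W h1W).trans hmiss, ?_⟩
  have hlog : n * ρ ≤ Real.logb 2 ((M₁ : ℝ) * M₂) :=
    (Real.le_logb_iff_rpow_le (by norm_num) (by positivity)).2 hM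
  have hlog0 : 0 < Real.logb 2 ((M₁ : ℝ) * M₂) := lt_of_lt_of_le (by positivity) hlog
  rw [entropy_msgLaw_codeOf, le_div_iff₀ hlog0]
  have hcond := le_condEntropy_codeOf ε₁ ε₂ f₁ f₂ h0W h1W
  have := mul_le_mul_of_nonneg_left hlog hδ.le
  linarith

/-- Codebook sizes that meet the requirements of random coding give achievable rates. -/
lemma achievable_of_sizes {ε₁ ε₂ εW : ℝ} (h0₁ : 0 ≤ ε₁) (h1₁ : ε₁ < 1 / 2) (h0₂ : 0 ≤ ε₂)
    (h1₂ : ε₂ < 1 / 2) (h0W : 0 ≤ εW) (h1W : εW < 1 / 2) {R₁ R₂ : ℝ}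
    (hsizes : ∀ δ : ℝ, 0 < δ → ∃ η > (0 : ℝ), ∃ ρ > (0 : ℝ), ∀ n : ℕ, ∃ M₁ L₁ M₂ L₂ : ℕ,
      0 < M₁ ∧ 0 < L₁ ∧ 0 < M₂ ∧ 0 < L₂ ∧
      ((M₁ : ℝ) - 1) * L₁ ≤ 2 * 2 ^ (n * (1 - (h ε₂ + 2 * η))) ∧
      ((M₂ : ℝ) - 1) * L₂ ≤ 2 * 2 ^ (n * (1 - (h ε₁ + 2 * η))) ∧
      (2 : ℝ) ^ (n * (1 - h εW)) ≤ L₁ * L₂ ∧ (2 : ℝ) ^ (n * ρ) ≤ M₁ * M₂ ∧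
      (2 : ℝ) ^ (n * (R₁ - δ)) ≤ M₁ ∧ (2 : ℝ) ^ (n * (R₂ - δ)) ≤ M₂) :
    Achievable ε₁ ε₂ εW R₁ R₂ := by
  intro δ hδ
  obtain ⟨η, hη, ρ, hρ, hs⟩ := hsizes δ hδ
  filter_upwards [eventually_exists_code h0₁ h1₁ h0₂ h1₂ h0W h1W hδ hη hρ,
    eventually_gt_atTop 0] with n hcode hn
  have hn' : (0 : ℝ) < n := by exact_mod_cast hn
  obtain ⟨M₁, L₁, M₂, L₂, hM₁, hL₁, hM₂, hL₂, hK₁, hK₂, hL, hM, hR₁, hR₂⟩ := hs n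
  obtain ⟨c, hc₁, hc₂, herr, hsec⟩ := hcode M₁ L₁ M₂ L₂ hM₁ hL₁ hM₂ hL₂ hK₁ hK₂ hL hM
  have rate : ∀ {M : ℕ} {r : ℝ}, 0 < M → (2 : ℝ) ^ (n * r) ≤ M →
      r ≤ 1 / (n : ℝ) * Real.logb 2 M := by
    intro M r hM hr
    rw [one_div, ← div_eq_inv_mul, le_div_iff₀ hn', mul_comm]
    exact (Real.le_logb_iff_rpow_le (by norm_num) (by exact_mod_cast hM)).2 hr
  exact ⟨c, by rw [hc₁]; exact rate hM₁ hR₁, by rw [hc₂]; exact rate hM₂ hR₂, herr, hsec⟩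

/-! ### Choice of the codebook sizes -/

/-- The `+ 1` in the number of messages is undone by the `- 1`; rounding up a number that is at
least `1` costs at most the factor `2`. -/
lemma floor_mul_ceil_le {r a C : ℝ} (ha : 0 ≤ a) (hC : r + a ≤ C) (n : ℕ) :
    (((⌊(2 : ℝ) ^ (n * r)⌋₊ + 1 : ℕ) : ℝ) - 1) * (⌈(2 : ℝ) ^ (n * a)⌉₊ : ℕ) ≤
      2 * 2 ^ (n * C) := by
  have hfl : (⌊(2 : ℝ) ^ (n * r)⌋₊ : ℝ) ≤ 2 ^ (n * r) := Nat.floor_le (by positivity)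
  have hce : (⌈(2 : ℝ) ^ (n * a)⌉₊ : ℝ) ≤ 2 * 2 ^ (n * a) := by
    have h1 : (1 : ℝ) ≤ 2 ^ (n * a) := Real.one_le_rpow (by norm_num) (by positivity)
    have h2 := Nat.ceil_lt_add_one (show (0 : ℝ) ≤ 2 ^ (n * a) by positivity)
    linarith
  calc (((⌊(2 : ℝ) ^ (n * r)⌋₊ + 1 : ℕ) : ℝ) - 1) * (⌈(2 : ℝ) ^ (n * a)⌉₊ : ℕ)
      = (⌊(2 : ℝ) ^ (n * r)⌋₊ : ℝ) * ⌈(2 : ℝ) ^ (n * a)⌉₊ := by push_cast; ring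
    _ ≤ 2 ^ (n * r) * (2 * 2 ^ (n * a)) := by gcongr
    _ = 2 * 2 ^ (n * (r + a)) := by rw [mul_add, Real.rpow_add two_pos]; ring
    _ ≤ 2 * 2 ^ (n * C) := by gcongr; norm_num

lemma two_rpow_le_floor_add_one {r s : ℝ} (h : s ≤ r) (n : ℕ) :
    (2 : ℝ) ^ (n * s) ≤ (⌊(2 : ℝ) ^ (n * r)⌋₊ + 1 : ℕ) := by
  calc (2 : ℝ) ^ (n * s) ≤ 2 ^ (n * r) := by gcongr; norm_num
    _ ≤ _ := by push_cast; exact (Nat.lt_floor_add_one _).le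

/-- Codebook sizes when a user with a single message jams with a uniformly random word. -/
lemma jamming_sizes {ξ ξ' εW : ℝ} (h1 : ξ < 1 / 2) (h0W : 0 ≤ εW) (h1W : εW < 1 / 2) {R R' : ℝ}
    (hR : R ≤ 1 - h ξ) (hR' : R' ≤ 0) {δ : ℝ} (hδ : 0 < δ) :
    ∃ η > (0 : ℝ), ∃ ρ > (0 : ℝ), ∀ n : ℕ, ∃ M L M' L' : ℕ, 0 < M ∧ 0 < L ∧ 0 < M' ∧ 0 < L' ∧
      ((M : ℝ) - 1) * L ≤ 2 * 2 ^ (n * (1 - (h ξ + 2 * η))) ∧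
      ((M' : ℝ) - 1) * L' ≤ 2 * 2 ^ (n * (1 - (h ξ' + 2 * η))) ∧
      (2 : ℝ) ^ (n * (1 - h εW)) ≤ L * L' ∧ (2 : ℝ) ^ (n * ρ) ≤ M * M' ∧
      (2 : ℝ) ^ (n * (R - δ)) ≤ M ∧ (2 : ℝ) ^ (n * (R' - δ)) ≤ M' := by
  have hC : 0 < 1 - h ξ := sub_pos.2 (h_lt_one h1)
  obtain ⟨η, hη, hηδ, hηC⟩ : ∃ η > 0, 2 * η ≤ δ ∧ 2 * η < 1 - h ξ :=
    ⟨min δ (1 - h ξ) / 4, by positivity, by linarith [min_le_left δ (1 - h ξ)],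
      by linarith [min_le_right δ (1 - h ξ)]⟩
  -- The informed user does not randomize: its `L` is `1`, written as a ceiling to fit
  -- `floor_mul_ceil_le`. The jammer has `M' = 1` and `L' = 2 ^ n`, enough to hide anything.
  refine ⟨η, hη, 1 - (h ξ + 2 * η), by linarith, fun n =>
    ⟨⌊(2 : ℝ) ^ (n * (1 - (h ξ + 2 * η)))⌋₊ + 1, ⌈(2 : ℝ) ^ (n * (0 : ℝ))⌉₊, 1, 2 ^ n,
      Nat.succ_pos _, Nat.ceil_pos.2 (by positivity), one_pos, by positivity,
      floor_mul_ceil_le le_rfl (by simp) n, ?_, ?_, ?_,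
      two_rpow_le_floor_add_one (by linarith) n, ?_⟩⟩
  · simp only [Nat.cast_one, sub_self, zero_mul]
    positivity
  · have := h_nonneg h0W h1W
    simp only [mul_zero, Real.rpow_zero, Nat.ceil_one, Nat.cast_one, one_mul, Nat.cast_pow,
      Nat.cast_ofNat]
    rw [← Real.rpow_natCast 2 n]
    exact Real.rpow_le_rpow_of_exponent_le (by norm_num)
      (mul_le_of_le_one_right (Nat.cast_nonneg n) (by linarith))
  · rw [Nat.cast_one, mul_one]
    exact two_rpow_le_floor_add_one le_rfl n
  · rw [Nat.cast_one]
    exact Real.rpow_le_one_of_one_le_of_nonpos (by norm_num)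
      (mul_nonpos_of_nonneg_of_nonpos (Nat.cast_nonneg n) (by linarith))

/-- Codebook sizes when both users have positive rates. -/
lemma two_way_sizes {ε₁ ε₂ εW R₁ R₂ : ℝ} (hpos₁ : 0 < R₁) (hpos₂ : 0 < R₂)
    (hR₁ : R₁ ≤ 1 - h ε₂) (hR₂ : R₂ ≤ 1 - h ε₁)
    (hsum : R₁ + R₂ ≤ 1 + h εW - h ε₁ - h ε₂) {δ : ℝ} (hδ : 0 < δ) :
    ∃ η > (0 : ℝ), ∃ ρ > (0 : ℝ), ∀ n : ℕ, ∃ M₁ L₁ M₂ L₂ : ℕ, 0 < M₁ ∧ 0 < L₁ ∧ 0 < M₂ ∧ 0 < L₂ ∧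
      ((M₁ : ℝ) - 1) * L₁ ≤ 2 * 2 ^ (n * (1 - (h ε₂ + 2 * η))) ∧
      ((M₂ : ℝ) - 1) * L₂ ≤ 2 * 2 ^ (n * (1 - (h ε₁ + 2 * η))) ∧
      (2 : ℝ) ^ (n * (1 - h εW)) ≤ L₁ * L₂ ∧ (2 : ℝ) ^ (n * ρ) ≤ M₁ * M₂ ∧
      (2 : ℝ) ^ (n * (R₁ - δ)) ≤ M₁ ∧ (2 : ℝ) ^ (n * (R₂ - δ)) ≤ M₂ := by
  obtain ⟨η, hη, hηδ, hηR⟩ : ∃ η > 0, 2 * η ≤ δ ∧ 4 * η < R₁ + R₂ :=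
    ⟨min δ (R₁ + R₂) / 8, by positivity,
      by linarith [min_le_left δ (R₁ + R₂)], by linarith [min_le_right δ (R₁ + R₂)]⟩
  -- The randomization exponents are capacity minus rate; the loss `2 * η` in the message rates is
  -- the decoding margin.
  refine ⟨η, hη, (R₁ - 2 * η) + (R₂ - 2 * η), by linarith, fun n =>
    ⟨⌊(2 : ℝ) ^ (n * (R₁ - 2 * η))⌋₊ + 1, ⌈(2 : ℝ) ^ (n * (1 - h ε₂ - R₁))⌉₊,
      ⌊(2 : ℝ) ^ (n * (R₂ - 2 * η))⌋₊ + 1, ⌈(2 : ℝ) ^ (n * (1 - h ε₁ - R₂))⌉₊,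
      Nat.succ_pos _, Nat.ceil_pos.2 (by positivity), Nat.succ_pos _,
      Nat.ceil_pos.2 (by positivity),
      floor_mul_ceil_le (by linarith) (by linarith) n,
      floor_mul_ceil_le (by linarith) (by linarith) n, ?_, ?_,
      two_rpow_le_floor_add_one (by linarith) n, two_rpow_le_floor_add_one (by linarith) n⟩⟩
  · calc (2 : ℝ) ^ (n * (1 - h εW)) ≤ 2 ^ (n * ((1 - h ε₂ - R₁) + (1 - h ε₁ - R₂))) := by
          gcongr
          · norm_num
          · linarith
      _ = 2 ^ (n * (1 - h ε₂ - R₁)) * 2 ^ (n * (1 - h ε₁ - R₂)) := by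
          rw [mul_add, Real.rpow_add two_pos]
      _ ≤ _ := by
          gcongr
          · exact Nat.le_ceil _
          · exact Nat.le_ceil _
  · rw [mul_add, Real.rpow_add two_pos]
    exact mul_le_mul (two_rpow_le_floor_add_one le_rfl n) (two_rpow_le_floor_add_one le_rfl n)
      (by positivity) (by positivity)

end BATW

theorem theorem2 (ε₁ ε₂ εW : ℝ)
    (hε₁ : 0 ≤ ε₁) (hε₁' : ε₁ < 1 / 2)
    (hε₂ : 0 ≤ ε₂) (hε₂' : ε₂ < 1 / 2)
    (hεW : 0 ≤ εW) (hεW' : εW < 1 / 2)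
    (R₁ R₂ : ℝ)
    (hR₁ : R₁ ≤ 1 - BATW.h ε₂)
    (hR₂ : R₂ ≤ 1 - BATW.h ε₁)
    (hsum : R₁ + R₂ ≤ max (1 + BATW.h εW - BATW.h ε₁ - BATW.h ε₂) 0) :
    BATW.Achievable ε₁ ε₂ εW R₁ R₂ := by
  refine BATW.achievable_of_sizes hε₁ hε₁' hε₂ hε₂' hεW hεW' fun δ hδ => ?_
  rcases le_or_gt R₂ 0 with h₂ | h₂
  · exact BATW.jamming_sizes hε₂' hεW hεW' hR₁ h₂ hδ
  rcases le_or_gt R₁ 0 with h₁ | h₁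
  · obtain ⟨η, hη, ρ, hρ, hs⟩ := BATW.jamming_sizes (ξ' := ε₂) hε₁' hεW hεW' hR₂ h₁ hδ
    refine ⟨η, hη, ρ, hρ, fun n => ?_⟩
    obtain ⟨M₂, L₂, M₁, L₁, hM₂, hL₂, hM₁, hL₁, hK₂, hK₁, hL, hM, hr₂, hr₁⟩ := hs n
    exact ⟨M₁, L₁, M₂, L₂, hM₁, hL₁, hM₂, hL₂, hK₁, hK₂, by rwa [mul_comm (L₁ : ℝ)],
      by rwa [mul_comm (M₁ : ℝ)], hr₁, hr₂⟩
  · refine BATW.two_way_sizes h₁ h₂ hR₁ hR₂ ?_ hδ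
    -- Two positive rates rule out the zero branch of the maximum.
    rcases le_max_iff.1 hsum with h | h
    · exact h
    · linarith
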